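/- Let $G=\mathbb R\ltimes\mathbb R$ be the affine group with law $(a,b)(a',b')=(a+a',\,b+e^{-a}b')$ and left Haar measure $d\mu(a,b)=e^{a}\,da\,db$, and let $C^*(G)$ be its group $C^*$-algebra, the completion of the convolution algebra $L^1(G,\mu)$ (with involution $f^*(a,b)=e^{-a}\,\overline{f(-a,-e^{a}b)}$) in the norm $\sup_\pi\|\pi(f)\|$ over all continuous unitary representations $\pi$ of $G$. Let $\mathcal A\subset C^*(G)$ be the $*$-subalgebra of smooth compactly supported functions $f$ on $G$. For $f\in\mathcal A$, presented as a function $\hat f(a,b)$, put $$\tilde f(a,\beta)=e^{a}\int_{\mathbb R}\hat f(a,b)\,e^{ib\beta}\,db,\qquad \check f(\alpha,\beta)=\int_{\mathbb R}\tilde f(a,\beta)\,e^{ia\alpha}\,da .$$ Let $\rho:C^*(G)\to C^*(\mathbb R)$ be the quotient map, i.e. the $*$-homomorphism with $\rho(f)(a)=\tilde f(a,0)$ for $f\in\mathcal A$; let $\mathcal F:C^*(\mathbb R)\to C_0(\widehat{\mathbb R})$ be the Fourier transform, $\mathcal F(g)(\alpha)=\int g(a)e^{ia\alpha}\,da$ for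 $g\in L^1(\mathbb R)$; and for $0\le\phi\in C_0(\widehat{\mathbb R})$ let $\tau_{\mathbb R}(\phi)=\int\phi(\alpha)\,d\alpha\in[0,\infty]$. Define $\tau:C^*(G)_+\to[0,\infty]$ by $\tau=\frac1{2\pi}\,\tau_{\mathbb R}\circ\mathcal F\circ\rho$, and let $\mathfrak M_\tau$ be the linear span in $C^*(G)$ of $\{f\in C^*(G)_+ : \tau(f)<\infty\}$. Then $\tau$ is a lower semicontinuous trace on $C^*(G)$ (additive and positively homogeneous on $C^*(G)_+$, with $\tau(x^*x)=\tau(xx^*)$ for all $x\in C^*(G)$), and $\mathfrak M_\tau$ contains $\mathcal A$. Moreover $\tau$ extends uniquely to a linear functional on $\mathfrak M_\tau$, again denoted $\tau$, and for every $f\in\mathcal A$ $$\tau(f)=\int_{\mathbb R}\hat f(0,b)\,db=\tilde f(0,0)=\frac1{2\pi}\int_{\mathbb R}\check f(\alpha,0)\,d\alpha ,$$ $$\tau(f^**f)=\int_{\mathbb R}|\tilde f(a,0)|^2\,da=\frac1{2\pi}\int_{\mathbb R}|\check f(\alpha,0)|^2\,d\alpha ,$$ all these integrals being absolutely convergent.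 -/

import Mathlib

open MeasureTheory Topology Filter
open scoped ENNReal NNReal ContDiff ZeroAtInfty

noncomputable section

namespace AffineCStar

/-! ## The full group `C⋆`-algebra of a topological group -/

/-- A strongly continuous unitary representation of `G` on a complex Hilbert space. -/
structure UnitaryRep (G : Type) [Group G] [TopologicalSpace G] : Type 1 where
  H : Type
  [normed : NormedAddCommGroup H]
  [inner : InnerProductSpace ℂ H]
  [complete : CompleteSpace H]
  toHom : G →* unitary (H →L[ℂ] H)
  continuous_apply : ∀ ξ : H, Continuous fun g : G => (toHom g : H →L[ℂ] H) ξ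

attribute [instance] UnitaryRep.normed UnitaryRep.inner UnitaryRep.complete

theorem UnitaryRep.norm_apply {G : Type} [Group G] [TopologicalSpace G] (π : UnitaryRep G)
    (g : G) (ξ : π.H) :
    ‖(π.toHom g : π.H →L[ℂ] π.H) ξ‖ = ‖ξ‖ :=
  Unitary.norm_map (π.toHom g) ξ

section GroupCStar

variable {G : Type} [Group G] [TopologicalSpace G] [SecondCountableTopology G]
  [MeasurableSpace G] [BorelSpace G]

theorem UnitaryRep.integrable (π : UnitaryRep G) {μ : Measure G} {f : G → ℂ}
    (hf : Integrable f μ) (ξ : π.H) :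
    Integrable (fun g => f g • (π.toHom g : π.H →L[ℂ] π.H) ξ) μ := by
  refine (hf.norm.mul_const ‖ξ‖).mono'
    (hf.aestronglyMeasurable.smul (π.continuous_apply ξ).aestronglyMeasurable) ?_
  filter_upwards with g
  rw [norm_smul, π.norm_apply]

/-- The integrated form `π(f) = ∫ f(g) π(g) dμ(g)` of a unitary representation, `f ∈ L¹(G, μ)`. -/
def UnitaryRep.integrated (π : UnitaryRep G) {μ : Measure G} (f : Lp ℂ 1 μ) :
    π.H →L[ℂ] π.H :=
  LinearMap.mkContinuous
    { toFun := fun ξ => ∫ g, f g • (π.toHom g : π.H →L[ℂ] π.H) ξ ∂μ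
      map_add' := fun ξ η => by
        simp only [map_add, smul_add]
        exact integral_add (π.integrable (L1.integrable_coeFn f) ξ)
          (π.integrable (L1.integrable_coeFn f) η)
      map_smul' := fun c ξ => by
        simp only [map_smul, RingHom.id_apply, ← integral_smul]
        congr 1; ext g; rw [smul_comm] }
    ‖f‖ (fun ξ => by
      refine (norm_integral_le_integral_norm _).trans ?_
      simp only [norm_smul, π.norm_apply]
      rw [integral_mul_const, L1.norm_eq_integral_norm])

theorem UnitaryRep.integrated_apply (π : UnitaryRep G) {μ : Measure G} (f : Lp ℂ 1 μ) (ξ : π.H) :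
    π.integrated f ξ = ∫ g, f g • (π.toHom g : π.H →L[ℂ] π.H) ξ ∂μ := rfl

theorem UnitaryRep.norm_integrated_le (π : UnitaryRep G) {μ : Measure G} (f : Lp ℂ 1 μ) :
    ‖π.integrated f‖ ≤ ‖f‖ :=
  LinearMap.mkContinuous_norm_le _ (norm_nonneg _) _

variable (G) in
/-- The `C⋆`-algebra of all bounded families of operators, indexed by all unitary representations
of `G`, with the supremum norm. -/
abbrev RepFamily : Type 1 := lp (fun π : UnitaryRep G => π.H →L[ℂ] π.H) ∞

/-- The family `(π(f))_π` of all integrated forms of `f ∈ L¹(G, μ)`. -/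
def universalRep {μ : Measure G} (f : Lp ℂ 1 μ) : RepFamily G :=
  ⟨fun π => π.integrated f, memℓp_infty ⟨‖f‖, by
    rintro _ ⟨π, rfl⟩; exact π.norm_integrated_le f⟩⟩

/-- The image of the full group `C⋆`-algebra in its universal representation: the closed
`⋆`-subalgebra generated by the `(π(f))_π`, `f ∈ L¹(G, μ)`.  For a left Haar measure `μ` this is
the completion of the convolution algebra `L¹(G, μ)`, with involution
`f⋆(g) = Δ(g)⁻¹ conj (f(g⁻¹))`, in the norm `sup_π ‖π(f)‖`. -/
def groupCStarSubalgebra (μ : Measure G) : NonUnitalStarSubalgebra ℂ (RepFamily G) :=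
  (NonUnitalStarAlgebra.adjoin ℂ (Set.range (universalRep (μ := μ)))).topologicalClosure

/-- The full group `C⋆`-algebra `C⋆(G)` (`μ` is a left Haar measure). -/
def GroupCStar (μ : Measure G) : Type 1 := groupCStarSubalgebra μ

instance (μ : Measure G) : NonUnitalCStarAlgebra (GroupCStar μ) :=
  NonUnitalStarSubalgebra.nonUnitalCStarAlgebra (groupCStarSubalgebra μ)
    (h_closed := NonUnitalStarSubalgebra.isClosed_topologicalClosure _)

/-- The usual order of a `C⋆`-algebra, given by its positive cone. -/
instance (μ : Measure G) : PartialOrder (GroupCStar μ) := CStarAlgebra.spectralOrder _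

instance (μ : Measure G) : StarOrderedRing (GroupCStar μ) := CStarAlgebra.spectralOrderedRing _

/-- The canonical map `L¹(G, μ) → C⋆(G)`. -/
def ofL1 {μ : Measure G} (f : Lp ℂ 1 μ) : GroupCStar μ :=
  ⟨universalRep f, NonUnitalStarSubalgebra.le_topologicalClosure _
    (NonUnitalStarAlgebra.subset_adjoin ℂ _ ⟨f, rfl⟩)⟩

/-- A continuous `⋆`-homomorphism which sends the generators into a closed `⋆`-subalgebra sends all of
`C⋆(G)` into it. -/
theorem map_mem_of_generators {μ : Measure G} {B : Type*} [NonUnitalCStarAlgebra B]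
    (φ : RepFamily G →⋆ₙₐ[ℂ] B) (S : NonUnitalStarSubalgebra ℂ B)
    (hS : IsClosed (S : Set B)) (h : ∀ f : Lp ℂ 1 μ, φ (universalRep f) ∈ S)
    (x : GroupCStar μ) : φ x.1 ∈ S := by
  have hφ : Continuous φ := AddMonoidHomClass.continuous_of_bound φ 1 fun y => by
    rw [one_mul]; exact NonUnitalStarAlgHom.norm_apply_le φ y
  have hle : groupCStarSubalgebra μ ≤ S.comap φ := by
    refine NonUnitalStarSubalgebra.topologicalClosure_minimal _ ?_ (hS.preimage hφ)
    refine NonUnitalStarAlgebra.adjoin_le ?_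
    rintro _ ⟨f, rfl⟩
    exact h f
  exact hle x.2

end GroupCStar

/-! ## Traces on `C⋆`-algebras -/

section Trace

variable {A : Type*} [NonUnitalCStarAlgebra A] [PartialOrder A] [StarOrderedRing A]

/-- A trace on a `C⋆`-algebra `A`: a map `φ : A₊ → [0, ∞]` which is additive, positively
homogeneous and satisfies `φ(x⋆x) = φ(xx⋆)` (with the convention `0 · ∞ = 0`). -/
structure IsTrace (φ : {x : A // 0 ≤ x} → ℝ≥0∞) : Prop where
  map_add : ∀ x y : {x : A // 0 ≤ x}, φ ⟨x + y, add_nonneg x.2 y.2⟩ = φ x + φ y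
  map_smul : ∀ (c : ℝ) (hc : 0 ≤ c) (x : {x : A // 0 ≤ x}),
    φ ⟨c • (x : A), smul_nonneg hc x.2⟩ = ENNReal.ofReal c * φ x
  map_star_mul_self : ∀ x : A,
    φ ⟨star x * x, star_mul_self_nonneg x⟩ = φ ⟨x * star x, mul_star_self_nonneg x⟩

/-- The linear span `𝔐_φ` of `{x ∈ A₊ | φ(x) < ∞}`. -/
def traceDomain (φ : {x : A // 0 ≤ x} → ℝ≥0∞) : Submodule ℂ A :=
  Submodule.span ℂ {x : A | ∃ hx : 0 ≤ x, φ ⟨x, hx⟩ < ⊤}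

/-- `T : 𝔐_φ → ℂ` extends `φ`, that is, `T(x) = φ(x)` for all `x ∈ A₊` with `φ(x) < ∞`. -/
def Extends (φ : {x : A // 0 ≤ x} → ℝ≥0∞) (T : traceDomain φ →ₗ[ℂ] ℂ) : Prop :=
  ∀ (x : A) (hx : 0 ≤ x) (h : φ ⟨x, hx⟩ < ⊤),
    T ⟨x, Submodule.subset_span ⟨hx, h⟩⟩ = ((φ ⟨x, hx⟩).toReal : ℂ)

end Trace

/-! ## The affine group and the line -/

/-- The group `G = ℝ ⋉ ℝ` with `(a, b) (a', b') = (a + a', b + e^{-a} b')`. -/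
def AffGroup : Type := ℝ × ℝ

namespace AffGroup

instance : TopologicalSpace AffGroup := inferInstanceAs (TopologicalSpace (ℝ × ℝ))
instance : SecondCountableTopology AffGroup :=
  inferInstanceAs (SecondCountableTopology (ℝ × ℝ))
instance : MeasurableSpace AffGroup := inferInstanceAs (MeasurableSpace (ℝ × ℝ))
instance : BorelSpace AffGroup := inferInstanceAs (BorelSpace (ℝ × ℝ))

instance : Mul AffGroup := ⟨fun p q => (p.1 + q.1, p.2 + Real.exp (-p.1) * q.2)⟩
instance : One AffGroup := ⟨((0 : ℝ), (0 : ℝ))⟩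
instance : Inv AffGroup := ⟨fun p => (-p.1, -(Real.exp p.1 * p.2))⟩

theorem mul_def (p q : AffGroup) : p * q = (p.1 + q.1, p.2 + Real.exp (-p.1) * q.2) := rfl
theorem one_def : (1 : AffGroup) = ((0 : ℝ), (0 : ℝ)) := rfl
theorem inv_def (p : AffGroup) : p⁻¹ = (-p.1, -(Real.exp p.1 * p.2)) := rfl

instance : Group AffGroup :=
  Group.ofLeftAxioms
    (fun p q r => by
      refine Prod.ext (add_assoc p.1 q.1 r.1) ?_
      change p.2 + Real.exp (-p.1) * q.2 + Real.exp (-(p.1 + q.1)) * r.2 =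
        p.2 + Real.exp (-p.1) * (q.2 + Real.exp (-q.1) * r.2)
      rw [neg_add, Real.exp_add]
      ring)
    (fun p => by
      refine Prod.ext (zero_add p.1) ?_
      change 0 + Real.exp (-0) * p.2 = p.2
      simp)
    (fun p => by
      refine Prod.ext (neg_add_cancel p.1) ?_
      change -(Real.exp p.1 * p.2) + Real.exp (- -p.1) * p.2 = 0
      simp)

/-- The left Haar measure `dμ(a, b) = e^a da db`. -/
def haar : Measure AffGroup :=
  (volume : Measure (ℝ × ℝ)).withDensity fun p => ENNReal.ofReal (Real.exp p.1)

end AffGroup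

instance : MeasurableSpace (Multiplicative ℝ) := inferInstanceAs (MeasurableSpace ℝ)
instance : BorelSpace (Multiplicative ℝ) := inferInstanceAs (BorelSpace ℝ)

/-- Lebesgue measure, the Haar measure of the (multiplicatively written) group `ℝ`. -/
def lineHaar : Measure (Multiplicative ℝ) := (volume : Measure ℝ)

/-- The homomorphism `G → ℝ`, `(a, b) ↦ a`. -/
def projLine : AffGroup →* Multiplicative ℝ where
  toFun p := Multiplicative.ofAdd p.1
  map_one' := rfl
  map_mul' _ _ := rfl

theorem continuous_projLine : Continuous projLine :=
  (continuous_fst : Continuous fun p : ℝ × ℝ => p.1)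

/-! ## The quotient map `ρ : C⋆(G) → C⋆(ℝ)` -/

/-- A representation of `ℝ`, seen as a representation of `G`. -/
def UnitaryRep.pullback (π : UnitaryRep (Multiplicative ℝ)) : UnitaryRep AffGroup where
  H := π.H
  toHom := π.toHom.comp projLine
  continuous_apply ξ := (π.continuous_apply ξ).comp continuous_projLine

/-- Restriction of a family of operators to the representations pulled back from `ℝ`. -/
def restrictFamily : RepFamily AffGroup →⋆ₙₐ[ℂ] RepFamily (Multiplicative ℝ) where
  toFun x := ⟨fun π => x π.pullback, memℓp_infty ⟨‖x‖, by
    rintro _ ⟨π, rfl⟩; exact lp.norm_apply_le_norm ENNReal.top_ne_zero x π.pullback⟩⟩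
  map_smul' _ _ := rfl
  map_zero' := rfl
  map_add' _ _ := rfl
  map_mul' _ _ := rfl
  map_star' _ := rfl

/-- The function `a ↦ e^a ∫ f(a, b) db` on `ℝ`. -/
def pushLine (f : AffGroup → ℂ) : Multiplicative ℝ → ℂ :=
  fun a => (Real.exp a.toAdd : ℂ) * ∫ b : ℝ, f (a.toAdd, b)

theorem integrable_exp_mul {f : AffGroup → ℂ} (hf : Integrable f AffGroup.haar) :
    Integrable (fun p : ℝ × ℝ => (Real.exp p.1 : ℂ) * f p) volume := by
  have h := (integrable_withDensity_iff_integrable_smul₀' (μ := (volume : Measure (ℝ × ℝ)))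
    (f := fun p : ℝ × ℝ => ENNReal.ofReal (Real.exp p.1)) (g := f)
    (by fun_prop) (ae_of_all _ fun _ => ENNReal.ofReal_lt_top)).1 hf
  refine h.congr (ae_of_all _ fun p => ?_)
  simp only [ENNReal.toReal_ofReal (Real.exp_pos _).le, Complex.real_smul]

theorem integrable_pushLine {f : AffGroup → ℂ} (hf : Integrable f AffGroup.haar) :
    Integrable (pushLine f) lineHaar := by
  have h := (integrable_exp_mul hf).integral_prod_left
  simp only [integral_const_mul] at h
  exact h

theorem restrictFamily_universalRep (f : Lp ℂ 1 AffGroup.haar) :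
    restrictFamily (universalRep f) =
      universalRep ((integrable_pushLine (L1.integrable_coeFn f)).toL1 (pushLine f)) := by
  refine Subtype.ext (funext fun π => ContinuousLinearMap.ext fun ξ => ?_)
  change (∫ p, f p • (π.toHom (projLine p) : π.H →L[ℂ] π.H) ξ ∂AffGroup.haar) =
    ∫ a, ((integrable_pushLine (L1.integrable_coeFn f)).toL1 (pushLine f) : Multiplicative ℝ → ℂ) a
      • (π.toHom a : π.H →L[ℂ] π.H) ξ ∂lineHaar
  have h1 : (∫ a, ((integrable_pushLine (L1.integrable_coeFn f)).toL1 (pushLine f) :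
      Multiplicative ℝ → ℂ) a • (π.toHom a : π.H →L[ℂ] π.H) ξ ∂lineHaar) =
      ∫ a : ℝ, pushLine f (Multiplicative.ofAdd a) •
        (π.toHom (Multiplicative.ofAdd a) : π.H →L[ℂ] π.H) ξ := by
    refine integral_congr_ae ?_
    filter_upwards [Integrable.coeFn_toL1 (integrable_pushLine (L1.integrable_coeFn f))]
      with a ha
    rw [ha]
    rfl
  have h2 : (∫ p, f p • (π.toHom (projLine p) : π.H →L[ℂ] π.H) ξ ∂AffGroup.haar) =
      ∫ p : ℝ × ℝ, ((Real.exp p.1 : ℂ) * f p) •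
        (π.toHom (Multiplicative.ofAdd p.1) : π.H →L[ℂ] π.H) ξ := by
    have h := integral_withDensity_eq_integral_toReal_smul₀ (μ := (volume : Measure (ℝ × ℝ)))
      (f := fun p : ℝ × ℝ => ENNReal.ofReal (Real.exp p.1)) (by fun_prop)
      (ae_of_all _ fun _ => ENNReal.ofReal_lt_top)
      (fun p : ℝ × ℝ => f p • (π.toHom (Multiplicative.ofAdd p.1) : π.H →L[ℂ] π.H) ξ)
    refine h.trans (integral_congr_ae (ae_of_all _ fun p => ?_))
    simp only [ENNReal.toReal_ofReal (Real.exp_pos _).le, mul_smul]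
    exact (Complex.coe_smul _ _).symm
  rw [h1, h2]
  have hint : Integrable (fun p : ℝ × ℝ => ((Real.exp p.1 : ℂ) * f p) •
      (π.toHom (Multiplicative.ofAdd p.1) : π.H →L[ℂ] π.H) ξ)
      ((volume : Measure ℝ).prod volume) := by
    have h0 := integrable_exp_mul (L1.integrable_coeFn f)
    refine (h0.norm.mul_const ‖ξ‖).mono' (h0.aestronglyMeasurable.smul
      (((π.continuous_apply ξ).comp continuous_projLine :
        Continuous fun p : ℝ × ℝ => (π.toHom (Multiplicative.ofAdd p.1) :
          π.H →L[ℂ] π.H) ξ)).aestronglyMeasurable) ?_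
    filter_upwards with p
    rw [norm_smul, π.norm_apply]
  rw [Measure.volume_eq_prod, integral_prod _ hint]
  refine integral_congr_ae (ae_of_all _ fun a => ?_)
  simp only [integral_smul_const, integral_const_mul]
  rfl

/-- The quotient map `ρ : C⋆(G) → C⋆(ℝ)`, determined by `f ↦ (a ↦ e^a ∫ f(a, b) db)` on
`L¹(G, μ)`. -/
def quotientMap : GroupCStar AffGroup.haar →⋆ₙₐ[ℂ] GroupCStar lineHaar where
  toFun x := ⟨restrictFamily x.1,
    map_mem_of_generators restrictFamily (groupCStarSubalgebra lineHaar)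
      (NonUnitalStarSubalgebra.isClosed_topologicalClosure _)
      (fun f => by
        rw [restrictFamily_universalRep]
        exact (ofL1 _).2) x⟩
  map_smul' _ _ := rfl
  map_zero' := rfl
  map_add' _ _ := rfl
  map_mul' _ _ := rfl
  map_star' _ := rfl

theorem quotientMap_ofL1 (f : Lp ℂ 1 AffGroup.haar) :
    quotientMap (ofL1 f) =
      ofL1 ((integrable_pushLine (L1.integrable_coeFn f)).toL1 (pushLine f)) :=
  Subtype.ext (restrictFamily_universalRep f)

/-! ## The Fourier transform `C⋆(ℝ) → C₀(ℝ̂)` -/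

/-- The character `a ↦ e^{i a α}` as an element of the unitary group of `ℂ →L[ℂ] ℂ`. -/
def charHom (α : ℝ) : Multiplicative ℝ →* unitary (ℂ →L[ℂ] ℂ) where
  toFun a := ⟨Complex.exp (Complex.I * (a.toAdd * α : ℝ)) • 1, by
    have h : star (Complex.exp (Complex.I * (a.toAdd * α : ℝ))) *
        Complex.exp (Complex.I * (a.toAdd * α : ℝ)) = 1 := by
      rw [Complex.star_def, ← Complex.exp_conj, ← Complex.exp_add]
      simp
    rw [Unitary.mem_iff]
    constructor
    · rw [star_smul, star_one, smul_mul_smul_comm, h, one_mul, one_smul]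
    · rw [star_smul, star_one, smul_mul_smul_comm, mul_comm, h, one_mul, one_smul]⟩
  map_one' := by
    refine Subtype.ext ?_
    simp
  map_mul' a b := by
    refine Subtype.ext ?_
    change Complex.exp (Complex.I * ((a.toAdd + b.toAdd) * α : ℝ)) • (1 : ℂ →L[ℂ] ℂ) =
      (Complex.exp (Complex.I * (a.toAdd * α : ℝ)) • (1 : ℂ →L[ℂ] ℂ)) *
        (Complex.exp (Complex.I * (b.toAdd * α : ℝ)) • (1 : ℂ →L[ℂ] ℂ))
    rw [smul_mul_smul_comm, ← Complex.exp_add, one_mul]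
    congr 2
    push_cast
    ring

/-- The one-dimensional representation of `ℝ` given by the character `a ↦ e^{i a α}`. -/
def charRep (α : ℝ) : UnitaryRep (Multiplicative ℝ) where
  H := ℂ
  toHom := charHom α
  continuous_apply ξ := by
    change Continuous fun a : ℝ => Complex.exp (Complex.I * (a * α : ℝ)) • ξ
    fun_prop

/-- The operator on `ℂ` in the family `x` at the character `a ↦ e^{i a α}`. -/
def atChar (x : RepFamily (Multiplicative ℝ)) (α : ℝ) : ℂ →L[ℂ] ℂ := x (charRep α)

/-- Evaluation of a family of operators at the characters of `ℝ`. -/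
def charFamily : RepFamily (Multiplicative ℝ) →⋆ₙₐ[ℂ] lp (fun _ : ℝ => ℂ) ∞ where
  toFun x := ⟨fun α => atChar x α 1, memℓp_infty ⟨‖x‖, by
    rintro _ ⟨α, rfl⟩
    refine ((atChar x α).le_opNorm 1).trans ?_
    rw [norm_one, mul_one]
    exact lp.norm_apply_le_norm ENNReal.top_ne_zero x (charRep α)⟩⟩
  map_smul' _ _ := rfl
  map_zero' := rfl
  map_add' _ _ := rfl
  map_mul' x y := by
    refine Subtype.ext (funext fun α => ?_)
    change atChar x α (atChar y α 1) =
      atChar x α 1 * atChar y α 1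
    have h := (atChar x α).map_smul (atChar y α 1) 1
    rw [smul_eq_mul, mul_one, smul_eq_mul] at h
    rw [h, mul_comm]
  map_star' x := by
    refine Subtype.ext (funext fun α => ?_)
    change (star (atChar x α)) 1 = star (atChar x α 1)
    have h := ContinuousLinearMap.adjoint_inner_right (atChar x α) (1 : ℂ) 1
    rw [ContinuousLinearMap.star_eq_adjoint]
    simpa using h

theorem charFamily_universalRep (f : Lp ℂ 1 lineHaar) (α : ℝ) :
    charFamily (universalRep f) α =
      ∫ a : ℝ, (f : Multiplicative ℝ → ℂ) a * Complex.exp (Complex.I * (a * α : ℝ)) := by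
  change (∫ a : ℝ, (f : Multiplicative ℝ → ℂ) a •
    (Complex.exp (Complex.I * (a * α : ℝ)) • (1 : ℂ))) = _
  simp only [smul_eq_mul, mul_one]

/-- The continuous functions vanishing at infinity, as a subalgebra of all bounded functions. -/
def c0Subalgebra : NonUnitalStarSubalgebra ℂ (lp (fun _ : ℝ => ℂ) ∞) where
  carrier := {u | Continuous (fun α => u α) ∧ Tendsto (fun α => u α) (cocompact ℝ) (𝓝 0)}
  add_mem' := fun {u v} hu hv => ⟨hu.1.add hv.1, by simpa using hu.2.add hv.2⟩
  zero_mem' := ⟨continuous_const, tendsto_const_nhds⟩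
  mul_mem' := fun {u v} hu hv => ⟨hu.1.mul hv.1, by simpa using hu.2.mul hv.2⟩
  smul_mem' := fun c {u} hu => ⟨hu.1.const_smul c, by simpa using hu.2.const_smul c⟩
  star_mem' := fun {u} hu => ⟨hu.1.star, by simpa using hu.2.star⟩

theorem isClosed_c0Subalgebra : IsClosed (c0Subalgebra : Set (lp (fun _ : ℝ => ℂ) ∞)) := by
  refine IsSeqClosed.isClosed fun u v hu huv => ?_
  have hunif : TendstoUniformly (fun n α => u n α) (fun α => v α) atTop := by
    rw [Metric.tendstoUniformly_iff]
    intro ε hε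
    filter_upwards [Metric.tendsto_nhds.1 huv ε hε] with n hn α
    rw [dist_comm, dist_eq_norm] at *
    refine lt_of_le_of_lt ?_ hn
    rw [norm_sub_rev]
    exact lp.norm_apply_le_norm ENNReal.top_ne_zero (v - u n) α
  refine ⟨hunif.continuous (Frequently.of_forall fun n => (hu n).1), ?_⟩
  rw [Metric.tendsto_nhds]
  intro ε hε
  obtain ⟨n, hn⟩ := ((Metric.tendstoUniformly_iff.1 hunif) (ε / 2) (half_pos hε)).exists
  filter_upwards [Metric.tendsto_nhds.1 (hu n).2 (ε / 2) (half_pos hε)] with α hα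
  calc dist (v α) 0 ≤ dist (v α) (u n α) + dist (u n α) 0 := dist_triangle _ _ _
    _ < ε := by linarith [hn α]

theorem charFamily_mem (x : GroupCStar lineHaar) : charFamily x.1 ∈ c0Subalgebra := by
  refine map_mem_of_generators charFamily c0Subalgebra isClosed_c0Subalgebra (fun f => ?_) x
  have hf : Integrable (fun a : ℝ => (f : Multiplicative ℝ → ℂ) a) := L1.integrable_coeFn f
  change Continuous (fun α => charFamily (universalRep f) α) ∧
    Tendsto (fun α => charFamily (universalRep f) α) (cocompact ℝ) (𝓝 0)
  simp only [charFamily_universalRep]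
  constructor
  · refine continuous_of_dominated (bound := fun a => ‖(f : Multiplicative ℝ → ℂ) a‖)
      (fun α => ?_) (fun α => ?_) hf.norm ?_
    · exact hf.aestronglyMeasurable.mul (Continuous.aestronglyMeasurable (by fun_prop))
    · refine ae_of_all _ fun a => ?_
      rw [norm_mul, mul_comm Complex.I, Complex.norm_exp_ofReal_mul_I, mul_one]
    · exact ae_of_all _ fun a => by fun_prop
  · have h := Real.tendsto_integral_exp_smul_cocompact (fun a => (f : Multiplicative ℝ → ℂ) a)
    have hc : Tendsto (fun α : ℝ => α * (-(2 * Real.pi))⁻¹) (cocompact ℝ) (cocompact ℝ) :=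
      (Homeomorph.mulRight₀ (-(2 * Real.pi))⁻¹
        (inv_ne_zero (neg_ne_zero.2 Real.two_pi_pos.ne'))).isClosedEmbedding.tendsto_cocompact
    refine (h.comp hc).congr fun α => ?_
    refine integral_congr_ae (ae_of_all _ fun a => ?_)
    simp only [Real.fourierChar_apply, Circle.smul_def, smul_eq_mul]
    rw [mul_comm]
    congr 2
    have hpi : (Real.pi : ℂ) ≠ 0 := by exact_mod_cast Real.pi_ne_zero
    push_cast
    field_simp

/-- The Fourier transform `𝓕 : C⋆(ℝ) → C₀(ℝ̂)`, determined by `f ↦ (α ↦ ∫ f(a) e^{i a α} da)`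
on `L¹(ℝ)`. -/
def fourierMap : GroupCStar lineHaar →⋆ₙₐ[ℂ] C₀(ℝ, ℂ) where
  toFun x := ⟨⟨fun α => charFamily x.1 α, (charFamily_mem x).1⟩, (charFamily_mem x).2⟩
  map_smul' _ _ := rfl
  map_zero' := rfl
  map_add' _ _ := rfl
  map_mul' x y := by
    ext α
    exact congrFun (congrArg Subtype.val (map_mul charFamily x.1 y.1)) α
  map_star' x := by
    ext α
    exact congrFun (congrArg Subtype.val (map_star charFamily x.1)) α

theorem fourierMap_ofL1 (f : Lp ℂ 1 lineHaar) (α : ℝ) :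
    fourierMap (ofL1 f) α =
      ∫ a : ℝ, (f : Multiplicative ℝ → ℂ) a * Complex.exp (Complex.I * (a * α : ℝ)) :=
  charFamily_universalRep f α

/-! ## The trace `τ` and the smooth algebra -/

/-- `τ_ℝ(φ) = ∫ φ(α) dα ∈ [0, ∞]` for a nonnegative function `φ ∈ C₀(ℝ̂)`. -/
def traceLine (φ : C₀(ℝ, ℂ)) : ℝ≥0∞ := ∫⁻ α : ℝ, ENNReal.ofReal (φ α).re

open scoped ComplexOrder in
theorem fourierMap_quotientMap_nonneg {x : GroupCStar AffGroup.haar} (hx : 0 ≤ x) (α : ℝ) :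
    0 ≤ fourierMap (quotientMap x) α := by
  obtain ⟨y, rfl⟩ := CStarAlgebra.nonneg_iff_eq_star_mul_self.1 hx
  rw [map_mul, map_mul, map_star, map_star]
  exact star_mul_self_nonneg (fourierMap (quotientMap y) α)

/-- `τ = (1 / 2π) τ_ℝ ∘ 𝓕 ∘ ρ` on the positive cone of `C⋆(G)`. -/
def tau (x : {x : GroupCStar AffGroup.haar // 0 ≤ x}) : ℝ≥0∞ :=
  ENNReal.ofReal (1 / (2 * Real.pi)) * traceLine (fourierMap (quotientMap x.1))

/-- The smooth functions with compact support on `G`, i.e. the elements of `𝒜 = 𝒟(G)`. -/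
structure TestFun where
  toFun : ℝ × ℝ → ℂ
  smooth : ContDiff ℝ ∞ toFun
  compact : HasCompactSupport toFun

namespace TestFun

theorem integrable (f : TestFun) : Integrable (f.toFun : AffGroup → ℂ) AffGroup.haar := by
  refine (integrable_withDensity_iff_integrable_smul₀' (μ := (volume : Measure (ℝ × ℝ)))
    (f := fun p : ℝ × ℝ => ENNReal.ofReal (Real.exp p.1)) (g := f.toFun)
    (by fun_prop) (ae_of_all _ fun _ => ENNReal.ofReal_lt_top)).2 ?_
  simp only [ENNReal.toReal_ofReal (Real.exp_pos _).le]
  exact Continuous.integrable_of_hasCompactSupport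
    (by have := f.smooth.continuous; fun_prop) f.compact.smul_left

/-- The element of `C⋆(G)` given by a smooth compactly supported function on `G`. -/
def toCStar (f : TestFun) : GroupCStar AffGroup.haar := ofL1 (f.integrable.toL1 _)

/-- `f̃(a, β) = e^a ∫ f(a, b) e^{i b β} db`. -/
def tilde (f : TestFun) (a β : ℝ) : ℂ :=
  (Real.exp a : ℂ) * ∫ b : ℝ, f.toFun (a, b) * Complex.exp (Complex.I * (b * β : ℝ))

/-- `f̌(α, β) = ∫ f̃(a, β) e^{i a α} da`. -/
def check (f : TestFun) (α β : ℝ) : ℂ :=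
  ∫ a : ℝ, f.tilde a β * Complex.exp (Complex.I * (a * α : ℝ))

end TestFun

end AffineCStar

end

open AffineCStar

noncomputable section

namespace AffineCStar

/-! Call `symbolMap x` the symbol of `x`. Up to the factor 1/2π, `tau` is Lebesgue integration of
the symbol, and the symbol is a ⋆-homomorphism into a commutative algebra of functions. The trace
identity is therefore automatic, additivity comes from pointwise positivity of symbols, and lower
semicontinuity is Fatou's lemma, since norm convergence in C⋆(G) forces pointwise convergence of
symbols.

The domain is identified in `mem_traceDomain_iff`: it consists of all elements with integrable
symbol. The point is that the positive and negative parts of a self-adjoint element have product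
zero, so their symbols never overlap and each is dominated by the symbol of the element itself
(`norm_symbolMap_le_sub_of_mul_eq_zero`). Integrating the symbol then gives a linear extension,
unique because the domain is spanned by the positive elements of finite trace.

For a test function the symbol is f̌(·, 0) (`TestFun.symbolMap_toCStar`), the Fourier transform of
the smooth compactly supported function f̃(·, 0). It is a rescaled Schwartz function, hence
integrable. Fourier inversion at 0 gives the formula for τ(f), and Plancherel the one for τ(f⋆f). -/

/-- The composition `𝓕 ∘ ρ : C⋆(G) → C₀(ℝ̂)`. -/
def symbolMap : GroupCStar AffGroup.haar →⋆ₙₐ[ℂ] C₀(ℝ, ℂ) :=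
  fourierMap.comp quotientMap

/-! ### Positivity of symbols and the trace property -/

open scoped ComplexOrder in
theorem symbolMap_nonneg {x : GroupCStar AffGroup.haar} (hx : 0 ≤ x) (α : ℝ) :
    0 ≤ symbolMap x α :=
  fourierMap_quotientMap_nonneg hx α

theorem symbolMap_re_nonneg {x : GroupCStar AffGroup.haar} (hx : 0 ≤ x) (α : ℝ) :
    0 ≤ (symbolMap x α).re :=
  (Complex.le_def.1 (symbolMap_nonneg hx α)).1

theorem ofReal_re_symbolMap {x : GroupCStar AffGroup.haar} (hx : 0 ≤ x) (α : ℝ) :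
    ((symbolMap x α).re : ℂ) = symbolMap x α :=
  Complex.ext rfl (Complex.le_def.1 (symbolMap_nonneg hx α)).2

theorem norm_symbolMap {x : GroupCStar AffGroup.haar} (hx : 0 ≤ x) (α : ℝ) :
    ‖symbolMap x α‖ = (symbolMap x α).re := by
  rw [← ofReal_re_symbolMap hx, Complex.norm_real, Real.norm_of_nonneg (symbolMap_re_nonneg hx α),
    Complex.ofReal_re]

theorem tau_apply (x : {x : GroupCStar AffGroup.haar // 0 ≤ x}) :
    tau x = ENNReal.ofReal (1 / (2 * Real.pi)) *
      ∫⁻ α : ℝ, ENNReal.ofReal (symbolMap (x : GroupCStar AffGroup.haar) α).re := rfl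

theorem measurable_ofReal_re_symbolMap (x : GroupCStar AffGroup.haar) :
    Measurable fun α : ℝ => ENNReal.ofReal (symbolMap x α).re := by
  have h : Continuous fun α : ℝ => symbolMap x α := (symbolMap x).continuous
  exact (Complex.continuous_re.comp h).measurable.ennreal_ofReal

theorem isTrace_tau : IsTrace tau where
  map_add x y := by
    simp only [tau_apply, ← mul_add]
    rw [← lintegral_add_left (measurable_ofReal_re_symbolMap _)]
    congr 1
    refine lintegral_congr fun α => ?_
    rw [← ENNReal.ofReal_add (symbolMap_re_nonneg x.2 α) (symbolMap_re_nonneg y.2 α), map_add]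
    rfl
  map_smul c hc x := by
    simp only [tau_apply]
    rw [mul_left_comm, ← lintegral_const_mul (ENNReal.ofReal c) (measurable_ofReal_re_symbolMap _)]
    congr 1
    refine lintegral_congr fun α => ?_
    rw [← ENNReal.ofReal_mul hc]
    congr 1
    have h : c • (x : GroupCStar AffGroup.haar) = (c : ℂ) • (x : GroupCStar AffGroup.haar) :=
      (Complex.coe_smul _ _).symm
    rw [h, map_smul, ZeroAtInftyContinuousMap.smul_apply, smul_eq_mul, Complex.re_ofReal_mul]
  -- The symbols of x⋆x and xx⋆ coincide because C₀(ℝ̂) is commutative.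
  map_star_mul_self x := by
    simp only [tau_apply, map_mul, map_star, mul_comm]

/-! ### Lower semicontinuity -/

/-- A ⋆-homomorphism of C⋆-algebras is contractive, and convergence in C₀ is uniform, hence
pointwise. -/
theorem continuous_symbolMap_apply (α : ℝ) : Continuous fun x => symbolMap x α := by
  have h : Continuous symbolMap := AddMonoidHomClass.continuous_of_bound symbolMap 1 fun y => by
    rw [one_mul]; exact NonUnitalStarAlgHom.norm_apply_le symbolMap y
  refine continuous_iff_continuousAt.2 fun x => ?_
  exact ((ZeroAtInftyContinuousMap.tendsto_iff_tendstoUniformly.1 (h.tendsto x)).tendsto_at α)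

/-- Sublevel sets are closed by Fatou's lemma; sequences suffice because the topology comes from a
norm. -/
theorem lowerSemicontinuous_tau : LowerSemicontinuous tau := by
  refine lowerSemicontinuous_iff_isClosed_preimage.2 fun c => IsSeqClosed.isClosed ?_
  intro u x hu hux
  have hlim (α : ℝ) : Tendsto (fun n => ENNReal.ofReal
      (symbolMap (u n : GroupCStar AffGroup.haar) α).re) atTop
      (𝓝 (ENNReal.ofReal (symbolMap (x : GroupCStar AffGroup.haar) α).re)) := by
    have h : Continuous fun y : {x : GroupCStar AffGroup.haar // 0 ≤ x} =>
        ENNReal.ofReal (symbolMap (y : GroupCStar AffGroup.haar) α).re :=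
      ENNReal.continuous_ofReal.comp (Complex.continuous_re.comp
        ((continuous_symbolMap_apply α).comp continuous_subtype_val))
    exact (h.tendsto x).comp hux
  change tau x ≤ c
  calc tau x
      = ∫⁻ α : ℝ, liminf (fun n => ENNReal.ofReal (1 / (2 * Real.pi)) * ENNReal.ofReal
          (symbolMap (u n : GroupCStar AffGroup.haar) α).re) atTop := by
        rw [tau_apply, ← lintegral_const_mul _ (measurable_ofReal_re_symbolMap _)]
        refine lintegral_congr fun α => ?_
        exact (ENNReal.Tendsto.const_mul (hlim α) (Or.inr ENNReal.ofReal_ne_top)).liminf_eq.symm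
    _ ≤ liminf (fun n => tau (u n)) atTop := by
        refine (lintegral_liminf_le fun n =>
          (measurable_ofReal_re_symbolMap _).const_mul _).trans (le_of_eq ?_)
        congr 1
        ext n
        rw [tau_apply, lintegral_const_mul _ (measurable_ofReal_re_symbolMap _)]
    _ ≤ c := by
        refine (liminf_le_liminf (Eventually.of_forall hu)).trans ?_
        simp

/-! ### The domain of the trace -/

theorem tau_lt_top_iff {x : GroupCStar AffGroup.haar} (hx : 0 ≤ x) :
    tau ⟨x, hx⟩ < ⊤ ↔ Integrable fun α : ℝ => symbolMap x α := by
  have hmeas : AEStronglyMeasurable (fun α : ℝ => symbolMap x α) :=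
    (symbolMap x).continuous.aestronglyMeasurable
  have hpos : ENNReal.ofReal (1 / (2 * Real.pi)) ≠ 0 := by
    rw [Ne, ENNReal.ofReal_eq_zero, not_le]; positivity
  have h : ∫⁻ α : ℝ, ENNReal.ofReal (symbolMap x α).re = ∫⁻ α : ℝ, ‖symbolMap x α‖ₑ := by
    refine lintegral_congr fun α => ?_
    rw [← norm_symbolMap hx, ofReal_norm]
  rw [tau_apply, h, Integrable, and_iff_right hmeas, HasFiniteIntegral]
  constructor
  · intro h1
    exact (ENNReal.lt_top_of_mul_ne_top_right h1.ne hpos)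
  · exact fun h1 => ENNReal.mul_lt_top ENNReal.ofReal_lt_top h1

theorem tau_toReal {x : GroupCStar AffGroup.haar} (hx : 0 ≤ x)
    (hint : Integrable fun α : ℝ => symbolMap x α) :
    tau ⟨x, hx⟩ = ENNReal.ofReal (1 / (2 * Real.pi) * ∫ α : ℝ, (symbolMap x α).re) := by
  have h := ofReal_integral_eq_lintegral_ofReal hint.re
    (ae_of_all _ fun α => symbolMap_re_nonneg hx α)
  rw [tau_apply, ENNReal.ofReal_mul (by positivity)]
  exact congrArg _ h.symm

theorem integrable_symbolMap_of_mem {x : GroupCStar AffGroup.haar} (hx : x ∈ traceDomain tau) :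
    Integrable fun α : ℝ => symbolMap x α := by
  induction hx using Submodule.span_induction with
  | mem x hx => exact (tau_lt_top_iff hx.1).1 hx.2
  | zero =>
    rw [map_zero]
    exact integrable_zero _ _ _
  | add x y _ _ hx hy =>
    rw [map_add]
    exact hx.add hy
  | smul c x _ hx =>
    rw [map_smul]
    exact hx.smul c

/-- The symbols multiply to zero in ℂ at each point, so one of them vanishes there and the
difference is the other up to sign. Used for p = x⁺, q = x⁻. -/
theorem norm_symbolMap_le_sub_of_mul_eq_zero {p q : GroupCStar AffGroup.haar} (hpq : p * q = 0) (α : ℝ) :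
    ‖symbolMap p α‖ ≤ ‖symbolMap (p - q) α‖ ∧ ‖symbolMap q α‖ ≤ ‖symbolMap (p - q) α‖ := by
  have h : symbolMap p α * symbolMap q α = 0 := by
    rw [← ZeroAtInftyContinuousMap.mul_apply, ← map_mul, hpq, map_zero]
    rfl
  rw [map_sub, ZeroAtInftyContinuousMap.sub_apply]
  rcases mul_eq_zero.1 h with h | h <;> simp [h]

theorem mem_traceDomain_of_isSelfAdjoint {x : GroupCStar AffGroup.haar} (hx : IsSelfAdjoint x)
    (hint : Integrable fun α : ℝ => symbolMap x α) : x ∈ traceDomain tau := by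
  have hsub : x⁺ - x⁻ = x := CFC.posPart_sub_negPart x hx
  have hle := norm_symbolMap_le_sub_of_mul_eq_zero (CFC.posPart_mul_negPart x)
  rw [hsub] at hle
  rw [← hsub]
  refine sub_mem (Submodule.subset_span ⟨CFC.posPart_nonneg x, (tau_lt_top_iff _).2 ?_⟩)
    (Submodule.subset_span ⟨CFC.negPart_nonneg x, (tau_lt_top_iff _).2 ?_⟩)
  · exact hint.mono (symbolMap _).continuous.aestronglyMeasurable (ae_of_all _ fun α => (hle α).1)
  · exact hint.mono (symbolMap _).continuous.aestronglyMeasurable (ae_of_all _ fun α => (hle α).2)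

open scoped ComplexStarModule in
/-- `𝔐_τ` consists of the elements whose image in `C₀(ℝ̂)` is integrable. -/
theorem mem_traceDomain_iff {x : GroupCStar AffGroup.haar} :
    x ∈ traceDomain tau ↔ Integrable fun α : ℝ => symbolMap x α := by
  refine ⟨integrable_symbolMap_of_mem, fun hint => ?_⟩
  have hstar : Integrable fun α : ℝ => symbolMap (star x) α := by
    rw [map_star]
    exact (Complex.conjLIE : ℂ →L[ℝ] ℂ).integrable_comp hint
  -- The real and imaginary parts of x are complex combinations of x and x⋆, so they inherit
  -- integrable symbols and fall under the self-adjoint case.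
  have key (y : GroupCStar AffGroup.haar) (hy : IsSelfAdjoint y) (c d : ℂ)
      (h : y = c • x + d • star x) : y ∈ traceDomain tau := by
    refine mem_traceDomain_of_isSelfAdjoint hy ?_
    rw [h, map_add, map_smul, map_smul]
    exact (hint.smul c).add (hstar.smul d)
  rw [← realPart_add_I_smul_imaginaryPart x]
  refine add_mem (key _ (ℜ x).2 (1 / 2) (1 / 2) ?_)
    (Submodule.smul_mem _ _ (key _ (ℑ x).2 (-Complex.I / 2) (Complex.I / 2) ?_))
  · rw [realPart_apply_coe, ← Complex.coe_smul, smul_add]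
    norm_num
  · rw [imaginaryPart_apply_coe, ← Complex.coe_smul, smul_sub, smul_sub, smul_smul, smul_smul]
    have h1 : -Complex.I * ((2⁻¹ : ℝ) : ℂ) = -Complex.I / 2 := by push_cast; ring
    have h2 : Complex.I / 2 = -(-Complex.I / 2) := by ring
    rw [h1, h2, neg_smul, sub_eq_add_neg]

/-! ### Existence and uniqueness of the linear extension -/

/-- The linear extension of `τ` to `𝔐_τ`, integration of the image in `C₀(ℝ̂)`. -/
def tauExtension : traceDomain tau →ₗ[ℂ] ℂ where
  toFun x := (1 / (2 * Real.pi) : ℝ) * ∫ α : ℝ, symbolMap (x : GroupCStar AffGroup.haar) α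
  map_add' x y := by
    rw [← mul_add, ← integral_add (integrable_symbolMap_of_mem x.2)
      (integrable_symbolMap_of_mem y.2), Submodule.coe_add, map_add]
    rfl
  map_smul' c x := by
    rw [RingHom.id_apply, smul_eq_mul, mul_left_comm, ← integral_const_mul c, Submodule.coe_smul,
      map_smul]
    rfl

theorem tauExtension_apply {x : GroupCStar AffGroup.haar} (hx : x ∈ traceDomain tau) :
    tauExtension ⟨x, hx⟩ = (1 / (2 * Real.pi) : ℝ) * ∫ α : ℝ, symbolMap x α := rfl

theorem extends_tauExtension : Extends tau tauExtension := by
  intro x hx h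
  have hint := (tau_lt_top_iff hx).1 h
  refine (tauExtension_apply _).trans ?_
  rw [tau_toReal hx hint, ENNReal.toReal_ofReal, Complex.ofReal_mul]
  · congr 1
    rw [← integral_complex_ofReal]
    exact integral_congr_ae (ae_of_all _ fun α => (ofReal_re_symbolMap hx α).symm)
  · exact mul_nonneg (by positivity) (integral_nonneg fun α => symbolMap_re_nonneg hx α)

theorem Extends.unique {A : Type*} [NonUnitalCStarAlgebra A] [PartialOrder A] [StarOrderedRing A]
    {φ : {x : A // 0 ≤ x} → ℝ≥0∞} {S T : traceDomain φ →ₗ[ℂ] ℂ}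
    (hS : Extends φ S) (hT : Extends φ T) : S = T := by
  refine LinearMap.ext fun ⟨x, hx⟩ => ?_
  refine Submodule.span_induction (p := fun x hx => S ⟨x, hx⟩ = T ⟨x, hx⟩) ?_ ?_ ?_ ?_ hx
  · rintro x ⟨hx, h⟩
    exact (hS x hx h).trans (hT x hx h).symm
  · exact (map_zero S).trans (map_zero T).symm
  · intro x y hx hy h1 h2
    have h3 : (⟨x + y, add_mem hx hy⟩ : traceDomain φ) = ⟨x, hx⟩ + ⟨y, hy⟩ := rfl
    rw [h3, map_add, map_add, h1, h2]
  · intro c x hx h1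
    have h3 : (⟨c • x, Submodule.smul_mem _ c hx⟩ : traceDomain φ) = c • ⟨x, hx⟩ := rfl
    rw [h3, map_smul, map_smul, h1]

/-! ### Integration along the fibres -/

/-- The integral over the second variable of a smooth compactly supported function is smooth. -/
theorem _root_.HasCompactSupport.contDiff_integral_prodMk {E : Type*} [NormedAddCommGroup E]
    [NormedSpace ℝ E] {F : ℝ × ℝ → E} {n : ℕ∞} (hc : HasCompactSupport F)
    (hF : ContDiff ℝ n F) : ContDiff ℝ n fun a : ℝ => ∫ b : ℝ, F (a, b) := by
  rw [← contDiffOn_univ]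
  have hk : IsCompact ((fun p : ℝ × ℝ => -p.2) '' tsupport F) :=
    hc.isCompact.image (by fun_prop)
  -- The fibre integral is the convolution of the constant 1 with b ↦ F(a, -b), evaluated at 0. The
  -- reflection undoes the sign in the convolution, and the reflected projection of the support is a
  -- compact set that serves all a at once.
  have h := contDiffOn_convolution_right_with_param_comp (𝕜 := ℝ) (μ := volume) (n := n)
    (ContinuousLinearMap.lsmul ℝ ℝ : ℝ →L[ℝ] E →L[ℝ] E) (v := fun _ : ℝ => (0 : ℝ))
    contDiffOn_const (f := fun _ : ℝ => (1 : ℝ)) (g := fun a b => F (a, -b)) isOpen_univ hk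
    (fun a b _ hb => by
      by_contra hne
      exact hb ⟨(a, -b), subset_tsupport _ hne, neg_neg b⟩)
    (locallyIntegrable_const 1)
    (hF.comp (contDiff_fst.prodMk contDiff_snd.neg)).contDiffOn
  refine h.congr fun a _ => ?_
  simp [convolution_def]

theorem _root_.HasCompactSupport.integral_prodMk {E : Type*} [NormedAddCommGroup E]
    [NormedSpace ℝ E] {F : ℝ × ℝ → E} (hc : HasCompactSupport F) :
    HasCompactSupport fun a : ℝ => ∫ b : ℝ, F (a, b) := by
  refine HasCompactSupport.intro (hc.isCompact.image continuous_fst) fun a ha => ?_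
  have h (b : ℝ) : F (a, b) = 0 := by
    by_contra hne
    exact ha ⟨(a, b), subset_tsupport _ hne, rfl⟩
  simp [h]

/-! ### Fourier analysis of test functions -/

namespace TestFun

theorem tilde_zero (f : TestFun) (a : ℝ) :
    f.tilde a 0 = (Real.exp a : ℂ) * ∫ b : ℝ, f.toFun (a, b) := by
  simp [tilde]

theorem contDiff_tilde_zero (f : TestFun) : ContDiff ℝ ∞ fun a : ℝ => f.tilde a 0 := by
  simp only [tilde_zero]
  exact (Complex.ofRealCLM.contDiff.comp Real.contDiff_exp).mul
    (f.compact.contDiff_integral_prodMk f.smooth)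

theorem hasCompactSupport_tilde_zero (f : TestFun) :
    HasCompactSupport fun a : ℝ => f.tilde a 0 := by
  simp only [tilde_zero]
  exact f.compact.integral_prodMk.mul_left

/-- The function `a ↦ f̃(a, 0)` as a Schwartz function. -/
def tildeSchwartz (f : TestFun) : SchwartzMap ℝ ℂ :=
  f.hasCompactSupport_tilde_zero.toSchwartzMap f.contDiff_tilde_zero

theorem tildeSchwartz_apply (f : TestFun) (a : ℝ) : f.tildeSchwartz a = f.tilde a 0 := rfl

open scoped FourierTransform

/-- The kernel of `𝓕` is e^{-2πi a ξ}, so e^{i a α} corresponds to the frequency ξ = -α/2π. -/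
theorem check_zero (f : TestFun) (α : ℝ) :
    f.check α 0 = 𝓕 f.tildeSchwartz ((-(2 * Real.pi))⁻¹ * α) := by
  rw [SchwartzMap.fourier_coe, Real.fourier_real_eq_integral_exp_smul]
  refine integral_congr_ae (ae_of_all _ fun a => ?_)
  simp only [tildeSchwartz_apply, smul_eq_mul]
  rw [mul_comm]
  congr 2
  have hpi : (Real.pi : ℂ) ≠ 0 := by exact_mod_cast Real.pi_ne_zero
  push_cast
  field_simp

theorem integrable_check_zero (f : TestFun) : Integrable fun α : ℝ => f.check α 0 := by
  simp only [check_zero]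
  exact (𝓕 f.tildeSchwartz).integrable.comp_mul_left'
    (inv_ne_zero (neg_ne_zero.2 Real.two_pi_pos.ne'))

/-- Fourier inversion at the origin; the Jacobian 2π of the frequency rescaling cancels the
prefactor. -/
theorem integral_check_zero (f : TestFun) :
    (1 / (2 * Real.pi) : ℝ) * ∫ α : ℝ, f.check α 0 = f.tilde 0 0 := by
  have hinv : 𝓕⁻ (𝓕 f.tildeSchwartz) 0 = f.tildeSchwartz 0 := by
    rw [FourierTransform.fourierInv_fourier_eq]
  rw [SchwartzMap.fourierInv_coe, Real.fourierInv_eq] at hinv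
  simp only [inner_zero_right, AddChar.map_zero_eq_one, one_smul] at hinv
  simp only [check_zero]
  rw [Measure.integral_comp_mul_left (fun α => 𝓕 f.tildeSchwartz α), hinv, inv_inv, abs_neg,
    abs_of_pos Real.two_pi_pos, Complex.real_smul, ← mul_assoc, ← Complex.ofReal_mul,
    one_div_mul_cancel Real.two_pi_pos.ne', Complex.ofReal_one, one_mul, tildeSchwartz_apply]

theorem integrable_norm_sq_schwartz (g : SchwartzMap ℝ ℂ) : Integrable fun a : ℝ => ‖g a‖ ^ 2 :=
  (memLp_two_iff_integrable_sq_norm g.continuous.aestronglyMeasurable).1 (g.memLp 2)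

theorem integrable_norm_sq_tilde_zero (f : TestFun) :
    Integrable fun a : ℝ => ‖f.tilde a 0‖ ^ 2 :=
  integrable_norm_sq_schwartz f.tildeSchwartz

theorem integrable_norm_sq_check_zero (f : TestFun) :
    Integrable fun α : ℝ => ‖f.check α 0‖ ^ 2 := by
  simp only [check_zero]
  exact (integrable_norm_sq_schwartz (𝓕 f.tildeSchwartz)).comp_mul_left'
    (inv_ne_zero (neg_ne_zero.2 Real.two_pi_pos.ne'))

/-- Plancherel for Schwartz functions, with the same cancellation of 2π. -/
theorem integral_norm_sq_check_zero (f : TestFun) :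
    1 / (2 * Real.pi) * ∫ α : ℝ, ‖f.check α 0‖ ^ 2 = ∫ a : ℝ, ‖f.tilde a 0‖ ^ 2 := by
  simp only [check_zero]
  rw [Measure.integral_comp_mul_left (fun α => ‖𝓕 f.tildeSchwartz α‖ ^ 2),
    SchwartzMap.integral_norm_sq_fourier, inv_inv, abs_neg, abs_of_pos Real.two_pi_pos,
    smul_eq_mul, ← mul_assoc, one_div_mul_cancel Real.two_pi_pos.ne', one_mul]
  rfl

/-! ### The symbol and trace of a test function -/

/-- The class of a smooth compactly supported function in `L¹(G, μ)`. -/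
def toL1 (f : TestFun) : Lp ℂ 1 AffGroup.haar := f.integrable.toL1 _

theorem toCStar_eq (f : TestFun) : f.toCStar = ofL1 f.toL1 := rfl

theorem coeFn_toL1 (f : TestFun) :
    (f.toL1 : AffGroup → ℂ) =ᵐ[(volume : Measure (ℝ × ℝ))] f.toFun := by
  have h : (f.toL1 : AffGroup → ℂ) =ᵐ[AffGroup.haar] f.toFun :=
    Integrable.coeFn_toL1 f.integrable
  -- The density e^a never vanishes, so Haar-null sets are Lebesgue-null.
  have hac : (volume : Measure (ℝ × ℝ)) ≪ AffGroup.haar :=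
    withDensity_absolutelyContinuous' (by fun_prop)
      (ae_of_all _ fun p => by simp [Real.exp_pos])
  exact hac.ae_le h

/-- `pushLine` is applied to a representative of an L¹ class. Two representatives agree almost
everywhere on almost every fibre, by Fubini for null sets, so the fibre integrals agree for almost
every a. -/
theorem pushLine_toL1_ae (f : TestFun) :
    pushLine f.toL1 =ᵐ[(volume : Measure ℝ)] fun a : ℝ => f.tilde a 0 := by
  have h : ∀ᵐ a : ℝ, ∀ᵐ b : ℝ, (f.toL1 : AffGroup → ℂ) (a, b) = f.toFun (a, b) :=
    Measure.ae_ae_of_ae_prod f.coeFn_toL1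
  filter_upwards [h] with a ha
  rw [tilde_zero, ← integral_congr_ae ha]
  rfl

/-- This links the operator algebra to the explicit integrals. It holds at every α, since the almost
everywhere identities are only used under the integral over a. -/
theorem symbolMap_toCStar (f : TestFun) (α : ℝ) : symbolMap f.toCStar α = f.check α 0 := by
  have h : ((integrable_pushLine (L1.integrable_coeFn f.toL1)).toL1 (pushLine f.toL1) :
      Multiplicative ℝ → ℂ) =ᵐ[(volume : Measure ℝ)] pushLine f.toL1 :=
    Integrable.coeFn_toL1 (integrable_pushLine (L1.integrable_coeFn f.toL1))
  change fourierMap (quotientMap f.toCStar) α = _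
  rw [toCStar_eq, quotientMap_ofL1, fourierMap_ofL1]
  refine integral_congr_ae ?_
  filter_upwards [h, f.pushLine_toL1_ae] with a h1 h2
  rw [h1, h2]

theorem toCStar_mem_traceDomain (f : TestFun) : f.toCStar ∈ traceDomain tau := by
  rw [mem_traceDomain_iff]
  simpa only [symbolMap_toCStar] using f.integrable_check_zero

/-- Multiplicativity of the symbol gives |f̌(·, 0)|² directly, so the convolution f⋆ * f need not be
computed as a function on G. -/
theorem tau_star_mul_self (f : TestFun) :
    tau ⟨star f.toCStar * f.toCStar, star_mul_self_nonneg _⟩ =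
      ENNReal.ofReal (1 / (2 * Real.pi) * ∫ α : ℝ, ‖f.check α 0‖ ^ 2) := by
  have h (α : ℝ) : symbolMap (star f.toCStar * f.toCStar) α = ((‖f.check α 0‖ ^ 2 : ℝ) : ℂ) := by
    rw [map_mul, map_star, ← symbolMap_toCStar]
    push_cast
    exact Complex.conj_mul' _
  rw [tau_toReal]
  · simp only [h, Complex.ofReal_re]
  · simp only [h]
    exact f.integrable_norm_sq_check_zero.ofReal

end TestFun

end AffineCStar

end
open AffineCStar
theorem mainTheorem10 :
    IsTrace tau ∧ LowerSemicontinuous tau ∧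
    (∀ f : TestFun, f.toCStar ∈ traceDomain tau) ∧
    (∃! T : traceDomain tau →ₗ[ℂ] ℂ, Extends tau T) ∧
    (∀ T : traceDomain tau →ₗ[ℂ] ℂ, Extends tau T →
      ∀ (f : TestFun) (hf : f.toCStar ∈ traceDomain tau),
        T ⟨f.toCStar, hf⟩ = ∫ b : ℝ, f.toFun (0, b) ∧
        T ⟨f.toCStar, hf⟩ = f.tilde 0 0 ∧
        MeasureTheory.Integrable (fun α : ℝ => f.check α 0) ∧
        T ⟨f.toCStar, hf⟩ = (1 / (2 * Real.pi) : ℝ) * ∫ α : ℝ, f.check α 0) ∧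
    (∀ f : TestFun,
      MeasureTheory.Integrable (fun a : ℝ => ‖f.tilde a 0‖ ^ 2) ∧
      tau ⟨star f.toCStar * f.toCStar, star_mul_self_nonneg _⟩ =
        ENNReal.ofReal (∫ a : ℝ, ‖f.tilde a 0‖ ^ 2) ∧
      MeasureTheory.Integrable (fun α : ℝ => ‖f.check α 0‖ ^ 2) ∧
      tau ⟨star f.toCStar * f.toCStar, star_mul_self_nonneg _⟩ =
        ENNReal.ofReal (1 / (2 * Real.pi) * ∫ α : ℝ, ‖f.check α 0‖ ^ 2)) := by
  refine ⟨isTrace_tau, lowerSemicontinuous_tau, TestFun.toCStar_mem_traceDomain,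
    ⟨tauExtension, extends_tauExtension, fun T hT => hT.unique extends_tauExtension⟩, ?_, ?_⟩
  · intro T hT f hf
    have h : T ⟨f.toCStar, hf⟩ = (1 / (2 * Real.pi) : ℝ) * ∫ α : ℝ, f.check α 0 := by
      -- By uniqueness, an arbitrary extension may be replaced by integration of the symbol.
      rw [hT.unique extends_tauExtension, tauExtension_apply]
      simp only [TestFun.symbolMap_toCStar]
    have h0 : f.tilde 0 0 = ∫ b : ℝ, f.toFun (0, b) := by
      rw [TestFun.tilde_zero, Real.exp_zero, Complex.ofReal_one, one_mul]
    have h1 := h.trans f.integral_check_zero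
    exact ⟨h1.trans h0, h1, f.integrable_check_zero, h⟩
  · intro f
    refine ⟨f.integrable_norm_sq_tilde_zero, ?_, f.integrable_norm_sq_check_zero,
      f.tau_star_mul_self⟩
    rw [f.tau_star_mul_self, f.integral_norm_sq_check_zero]
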